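/- Let $\mathcal N_c$ be the variety of nilpotent groups of class at most $c$. For a group $G$ and a free presentation $1\to R\to F\to G\to 1$ ($F$ a free group of any rank), let $$\mathcal N_cM(G)=\frac{R\cap\gamma_{c+1}(F)}{[R,\,{}_cF]}$$ be the Baer invariant (higher Schur multiplier) of $G$ with respect to $\mathcal N_c$, where $\gamma_1(F)=F$, $\gamma_{i+1}(F)=[\gamma_i(F),F]$, $[R,\,{}_0F]=R$ and $[R,\,{}_{i+1}F]=[[R,\,{}_iF],F]$. Theorem. Let $r$, $s$ and $c$ be positive integers and let $d=\gcd(r,s)$. Let $G$ be the group $\langle x,y\mid x^r,\,y^s,\,\gamma_2\rangle$, where $\gamma_2$ is the commutator subgroup of the free group on $x,y$, or the (isomorphic) group $\mathbb Z_r\times\mathbb Z_s$, where $\mathbb Z_m$ is the cyclic group of order $m$. Then, for every free presentation of $G$, $$\mathcal N_cM(G)\cong\underbrace{\mathbb Z_d\oplus\cdots\oplus\mathbb Z_d}_{\rho(c+1)\text{ copies}},$$ where $\rho(c+1)$ is the number of basic commutators of weight $c+1$ on two letters. Here the basic commutators are formal brackets, defined with respect to any total order on the brackets in which those of smaller weight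 (number of letters, with multiplicity) come first: each letter is basic, and $[u,v]$ is basic if and only if $u$ and $v$ are basic, $v<u$, and $u_2\le v$ whenever $u=[u_1,u_2]$. -/

import Mathlib

namespace Baer

/-- The iterated commutator subgroup `[R, F, …, F]` with `c` copies of `F`, left-normed. -/
def iterCommutator {F : Type*} [Group F] (R : Subgroup F) : ℕ → Subgroup F
  | 0 => R
  | c + 1 => ⁅iterCommutator R c, (⊤ : Subgroup F)⁆

instance iterCommutator_normal {F : Type*} [Group F] (R : Subgroup F) [hR : R.Normal] (c : ℕ) :
    (iterCommutator R c).Normal := by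
  induction c with
  | zero => exact hR
  | succ c ih =>
    have := ih
    exact Subgroup.commutator_normal (iterCommutator R c) ⊤

/-- The group `(R ∩ γ_{c+1}(F)) / [R, F, …, F]` (`c` copies of `F`) of a presentation
`π : F → G` with `R = ker π`. When `F` is free and `π` is surjective, this is the Baer invariant
(higher Schur multiplier) of `G` with respect to the variety of nilpotent groups of class at most
`c`. Mathlib's lower central series starts at index `0`, so that
`(⊤ : Subgroup F).lowerCentralSeries c` is `γ_{c+1}(F)`. -/
abbrev NilpotentMultiplier {F G : Type*} [Group F] [Group G] (π : F →* G) (c : ℕ) : Type _ :=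
  ↥(π.ker ⊓ (⊤ : Subgroup F).lowerCentralSeries c) ⧸
    (iterCommutator π.ker c).subgroupOf (π.ker ⊓ (⊤ : Subgroup F).lowerCentralSeries c)

/-- The relators `x ^ r`, `y ^ s` and all elements of `γ_{n+1}` in the free group on
`x = of 0` and `y = of 1`. -/
def cyclicProductRels (r s n : ℕ) : Set (FreeGroup (Fin 2)) :=
  {FreeGroup.of 0 ^ r, FreeGroup.of 1 ^ s} ∪
    ((⊤ : Subgroup (FreeGroup (Fin 2))).lowerCentralSeries n : Set (FreeGroup (Fin 2)))

/-- The `n`-th nilpotent product of the cyclic groups of orders `r` and `s`, that is, the group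
`⟨x, y ∣ x ^ r, y ^ s, γ_{n+1}⟩`. -/
abbrev CyclicNilpotentProduct (r s n : ℕ) : Type :=
  PresentedGroup (cyclicProductRels r s n)

/-- Basic commutators on the alphabet `α`, as formal brackets; `u * v` stands for `[u, v]`.
The weight of a bracket is its `FreeMagma.length`, and the linear order is to be one in which
brackets of smaller weight come first. Every letter is basic, and `[u, v]` is basic when `u` and
`v` are, `v < u`, and `u₂ ≤ v` in case `u = [u₁, u₂]`. -/
inductive IsBasicCommutator {α : Type*} [LinearOrder (FreeMagma α)] : FreeMagma α → Prop
  | of (a : α) : IsBasicCommutator (FreeMagma.of a)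
  | mul (u v : FreeMagma α) (hu : IsBasicCommutator u) (hv : IsBasicCommutator v) (hvu : v < u)
      (h : ∀ u₁ u₂ : FreeMagma α, u = u₁ * u₂ → u₂ ≤ v) : IsBasicCommutator (u * v)

/-- The number of basic commutators of weight `n` on the alphabet `α`. -/
noncomputable def numBasicCommutators (α : Type*) [LinearOrder (FreeMagma α)] (n : ℕ) : ℕ :=
  Nat.card {b : FreeMagma α // IsBasicCommutator b ∧ b.length = n}

end Baer

/-!
Write `F` for the free group on `x, y`, let `R` be the kernel of a presentation `F → G`, and put
`d = gcd r s`.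

The Baer invariant does not depend on the free presentation
(`nonempty_mulEquiv_nilpotentMultiplier`): homomorphisms between two presentations over `G` exist
by freeness, and two such homomorphisms agree on `γ_{c+1}` modulo `[R, F, …, F]`
(`map_div_map_mem`). So it may be computed from `R = ⟨x ^ r, y ^ s⟩ γ₂(F)`. Since `γ₂(F) ≤ R`, it
is `γ_{c+1}(F) / K` with `K = [R, F, …, F]`, and `γ_{c+2}(F) ≤ K`. This quotient is abelian, and
there are two things to see.

*Upper bound.* The basic commutators of weight `c + 1` generate `γ_{c+1}` modulo `γ_{c+2}`
(`weightSeries_le_basicSubgroup_self`), by the Jacobi identity in the group modulo terms of higher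
weight. Moreover `w ^ d ∈ K` for `w ∈ γ_{c+1}` (`pow_gcd_mem_iterCommutator`), because
`[x, y] ^ r` and `[x, y] ^ s` are `[x ^ r, y]` and `[x, y ^ s]` up to higher commutators.

*Lower bound.* Let `A` be the free associative algebra over `ℤ/d` on two letters. The Magnus
homomorphism from `F` to the units of `A⟦t⟧` sends each letter `a` to `1 + a t`. The image of
`γ_n` is congruent to `1` modulo `t ^ n`, and its coefficient at `t ^ n` turns group commutators
into ring commutators. Over `ℤ/d` the image of `R` is congruent to `1` modulo `t ^ 2`, because `r`
and `s` vanish there, so the image of `K` is congruent to `1` modulo `t ^ (c + 2)`. Hence the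
coefficient at `t ^ (c + 1)` is a homomorphism from `γ_{c+1} / K` to `A` that sends each basic
commutator to its value in `A`. These values are linearly independent over `ℤ/d`
(`linearIndependent_ringBracket`), so the basic commutators form a basis of `γ_{c+1} / K` over
`ℤ/d`.

For the linear independence, consider the products of nondecreasing sequences of basic commutators
of total weight `n`. Exchanging adjacent factors costs shorter products only, so they span the
component of `A` of degree `n`. Deleting the brackets maps these sequences injectively to words of
length `n`, since a collecting process recovers the sequence from its word
(`collect_flatMap_foliage`). A spanning family of a free module of finite rank that is no larger
than a basis is linearly independent, over every commutative ring.
-/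

namespace Baer

open Subgroup
open scoped commutatorElement

/-! ### Commutator calculus modulo a normal subgroup -/

section Commutators

variable {F : Type*} [Group F]

theorem iterCommutator_top (n : ℕ) :
    iterCommutator (⊤ : Subgroup F) n = (⊤ : Subgroup F).lowerCentralSeries n := by
  induction n with
  | zero => rfl
  | succ n ih => rw [iterCommutator, ih, Subgroup.lowerCentralSeries_succ]

theorem iterCommutator_mono {R S : Subgroup F} (h : R ≤ S) (n : ℕ) :
    iterCommutator R n ≤ iterCommutator S n := by
  induction n with
  | zero => exact h
  | succ n ih => exact commutator_mono ih le_rfl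

theorem iterCommutator_iterCommutator (R : Subgroup F) (m n : ℕ) :
    iterCommutator (iterCommutator R m) n = iterCommutator R (m + n) := by
  induction n with
  | zero => rfl
  | succ n ih => rw [iterCommutator, ih]; rfl

/-- If `R` contains the commutator subgroup, then `[R, F, …, F]` with `n` copies of `F` contains
the term of the lower central series of the next weight. -/
theorem lowerCentralSeries_le_iterCommutator {R : Subgroup F}
    (h : (⊤ : Subgroup F).lowerCentralSeries 1 ≤ R) (n : ℕ) :
    (⊤ : Subgroup F).lowerCentralSeries (n + 1) ≤ iterCommutator R n := by
  rw [← iterCommutator_top, add_comm, ← iterCommutator_iterCommutator, iterCommutator_top]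
  exact iterCommutator_mono h n

/-- The three subgroups lemma, modulo a normal subgroup. -/
theorem commutator_commutator_le_of_rotate {A B C N : Subgroup F} [N.Normal]
    (h₁ : ⁅⁅B, C⁆, A⁆ ≤ N) (h₂ : ⁅⁅C, A⁆, B⁆ ≤ N) : ⁅⁅A, B⁆, C⁆ ≤ N := by
  have key : ∀ H : Subgroup F, H.map (QuotientGroup.mk' N) = ⊥ ↔ H ≤ N := fun H => by
    rw [Subgroup.map_eq_bot_iff, QuotientGroup.ker_mk']
  rw [← key, map_commutator, map_commutator] at *
  exact commutator_commutator_eq_bot_of_rotate h₁ h₂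

theorem commutator_iterCommutator_lowerCentralSeries_le (R : Subgroup F) [R.Normal] (i j : ℕ) :
    ⁅iterCommutator R i, (⊤ : Subgroup F).lowerCentralSeries j⁆ ≤ iterCommutator R (i + j + 1) := by
  induction j generalizing i with
  | zero => exact le_rfl
  | succ j ih =>
    rw [Subgroup.lowerCentralSeries_succ, commutator_comm]
    apply commutator_commutator_le_of_rotate
    · rw [commutator_comm ⊤]
      refine (ih (i + 1)).trans (le_of_eq ?_)
      congr 1
      omega
    · exact commutator_mono (ih i) le_rfl

/-- The lower central series indexed by weight: `weightSeries F n` is `γ_n(F)` for `n ≥ 1`, and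
the whole group for `n = 0`. -/
def weightSeries (F : Type*) [Group F] (n : ℕ) : Subgroup F :=
  (⊤ : Subgroup F).lowerCentralSeries (n - 1)

instance weightSeries_normal (n : ℕ) : (weightSeries F n).Normal := by
  unfold weightSeries; infer_instance

theorem weightSeries_antitone : Antitone (weightSeries F) := fun _ _ h =>
  Subgroup.lowerCentralSeries_antitone _ (Nat.sub_le_sub_right h 1)

theorem commutator_weightSeries_top {n : ℕ} (hn : 1 ≤ n) :
    ⁅weightSeries F n, (⊤ : Subgroup F)⁆ = weightSeries F (n + 1) := by
  obtain ⟨n, rfl⟩ := Nat.exists_eq_add_of_le' hn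
  rfl

theorem commutator_weightSeries_le (i j : ℕ) :
    ⁅weightSeries F i, weightSeries F j⁆ ≤ weightSeries F (i + j) := by
  rcases i with _ | i
  · exact (commutator_le_right _ _).trans (by rw [zero_add])
  rcases j with _ | j
  · exact commutator_le_left _ _
  have := commutator_iterCommutator_lowerCentralSeries_le (⊤ : Subgroup F) i j
  rw [iterCommutator_top, iterCommutator_top] at this
  refine this.trans (le_of_eq ?_)
  unfold weightSeries
  congr 1
  omega

theorem commutator_mem_weightSeries {i j k : ℕ} {a b : F} (ha : a ∈ weightSeries F i)
    (hb : b ∈ weightSeries F j) (h : k ≤ i + j) : ⁅a, b⁆ ∈ weightSeries F k :=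
  weightSeries_antitone h (commutator_weightSeries_le i j (commutator_mem_commutator ha hb))

theorem commutator_mem_of_mem_closure {N : Subgroup F} [hN : N.Normal] {T : Set F} {b : F}
    (h : ∀ t ∈ T, ⁅t, b⁆ ∈ N) {a : F} (ha : a ∈ closure T) : ⁅a, b⁆ ∈ N := by
  induction ha using closure_induction with
  | mem x hx => exact h x hx
  | one => simp
  | mul x y _ _ hx hy =>
    rw [commutatorElement_mul_left_eq_conj_mul]
    exact N.mul_mem (hN.conj_mem _ hy _) hx
  | inv x _ hx =>
    rw [commutatorElement_inv_left, ← commutatorElement_inv]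
    simpa using hN.conj_mem _ (N.inv_mem hx) x⁻¹

theorem commutatorElement_mem_comm {N : Subgroup F} {a b : F} : ⁅a, b⁆ ∈ N ↔ ⁅b, a⁆ ∈ N := by
  rw [← commutatorElement_inv, inv_mem_iff]

theorem commutatorElement_mem_iff_commute {N : Subgroup F} [N.Normal] {a b : F} :
    ⁅a, b⁆ ∈ N ↔ Commute (a : F ⧸ N) (b : F ⧸ N) := by
  rw [← commutatorElement_eq_one_iff_commute, ← QuotientGroup.eq_one_iff]
  rfl

/-- If `[[c, a], b]` and `[[c, b], a]` vanish and `[c, a]`, `[c, b]`, `[a, b]` commute with each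
other, then `[c, [a, b]]` vanishes: conjugation by `c` multiplies `a` and `b` by `[c, a]` and
`[c, b]`, which does not change `[a, b]`. -/
theorem commute_commutatorElement_of_commute {a b c : F} (h₁ : Commute ⁅c, a⁆ b)
    (h₂ : Commute ⁅c, b⁆ a) (h₃ : Commute ⁅c, a⁆ ⁅c, b⁆) (h₄ : Commute ⁅c, a⁆ ⁅a, b⁆)
    (h₅ : Commute ⁅c, b⁆ ⁅a, b⁆) : Commute c ⁅a, b⁆ := by
  have e : c * ⁅a, b⁆ * c⁻¹ = ⁅⁅c, a⁆ * a, ⁅c, b⁆ * b⁆ := by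
    rw [conjugate_commutatorElement]
    simp [commutatorElement_def, mul_assoc]
  generalize ⁅c, a⁆ = p at *
  generalize ⁅c, b⁆ = q at *
  have e₂ : ⁅p * a, q * b⁆ = p * q * ⁅a, b⁆ * p⁻¹ * q⁻¹ := by
    simp only [commutatorElement_def, mul_inv_rev]
    calc p * a * (q * b) * (a⁻¹ * p⁻¹) * (b⁻¹ * q⁻¹)
        = p * (a * q) * b * a⁻¹ * (p⁻¹ * b⁻¹) * q⁻¹ := by group
      _ = p * (q * a) * b * a⁻¹ * (b⁻¹ * p⁻¹) * q⁻¹ := by rw [h₂.eq, (h₁.inv_inv).eq]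
      _ = _ := by group
  have e₃ : p * q * ⁅a, b⁆ * p⁻¹ * q⁻¹ = ⁅a, b⁆ := by
    rw [mul_assoc p, h₅.eq, ← mul_assoc, h₄.eq, mul_assoc _ p q, h₃.eq]
    group
  exact mul_inv_eq_iff_eq_mul.mp (e.trans (e₂.trans e₃))

/-- The consequence of the Jacobi identity that straightening needs, modulo a normal subgroup that
contains `γ_{i+j+k+1}`. -/
theorem commutatorElement_commutatorElement_mem {N : Subgroup F} [N.Normal] {i j k : ℕ}
    {a b c : F} (ha : a ∈ weightSeries F i) (hb : b ∈ weightSeries F j)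
    (hc : c ∈ weightSeries F k) (hi : 1 ≤ i) (hj : 1 ≤ j) (hk : 1 ≤ k)
    (hN : weightSeries F (i + j + k + 1) ≤ N) (h₁ : ⁅⁅a, c⁆, b⁆ ∈ N) (h₂ : ⁅⁅b, c⁆, a⁆ ∈ N) :
    ⁅⁅a, b⁆, c⁆ ∈ N := by
  have hca := commutator_mem_weightSeries hc ha le_rfl
  have hcb := commutator_mem_weightSeries hc hb le_rfl
  have hab := commutator_mem_weightSeries ha hb le_rfl
  have h₁' : ⁅⁅c, a⁆, b⁆ ∈ N := by
    rw [commutatorElement_mem_iff_commute] at h₁ ⊢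
    rw [← commutatorElement_inv]
    exact h₁.inv_left
  have h₂' : ⁅⁅c, b⁆, a⁆ ∈ N := by
    rw [commutatorElement_mem_iff_commute] at h₂ ⊢
    rw [← commutatorElement_inv]
    exact h₂.inv_left
  have h₃ := hN (commutator_mem_weightSeries hca hcb (by omega))
  have h₄ := hN (commutator_mem_weightSeries hca hab (by omega))
  have h₅ := hN (commutator_mem_weightSeries hcb hab (by omega))
  rw [commutatorElement_mem_comm]
  rw [commutatorElement_mem_iff_commute] at *
  exact commute_commutatorElement_of_commute (F := F ⧸ N) (a := a) (b := b) (c := c)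
    h₁' h₂' h₃ h₄ h₅

theorem commutatorElement_pow_left {a b : F} (h : Commute a ⁅a, b⁆) (n : ℕ) :
    ⁅a ^ n, b⁆ = ⁅a, b⁆ ^ n := by
  induction n with
  | zero => simp
  | succ n ih =>
    rw [pow_succ', commutatorElement_mul_left_eq_conj_mul, ih, (h.pow_right n).eq, pow_succ]
    group

/-- `[a, b] ^ n` and `[a ^ n, b]` agree modulo a normal subgroup that contains `[a, [a, b]]`, so if
it contains the second it contains the first. -/
theorem commutatorElement_pow_mem {N : Subgroup F} [N.Normal] {a b : F} (h : ⁅a, ⁅a, b⁆⁆ ∈ N)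
    {n : ℕ} (hn : ⁅a ^ n, b⁆ ∈ N) : ⁅a, b⁆ ^ n ∈ N := by
  rw [commutatorElement_mem_iff_commute] at h
  have := commutatorElement_pow_left (F := F ⧸ N) (a := a) (b := b) h n
  rw [← QuotientGroup.eq_one_iff] at hn ⊢
  exact this.symm.trans hn

/-- If `H` is central modulo `N`, then taking `n`-th powers is multiplicative on `H` modulo `N`, so
`n`-th powers lie in `N` as soon as those of generators do. -/
theorem pow_mem_of_mem_closure {N H : Subgroup F} [N.Normal] (hHN : ⁅H, (⊤ : Subgroup F)⁆ ≤ N)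
    {T : Set F} (hT : T ⊆ H) {n : ℕ} (h : ∀ t ∈ T, t ^ n ∈ N) {a : F} (ha : a ∈ closure T) :
    a ^ n ∈ N := by
  induction ha using closure_induction with
  | mem x hx => exact h x hx
  | one => simp
  | mul x y hx _ ihx ihy =>
    have hc : Commute (x : F ⧸ N) (y : F ⧸ N) := commutatorElement_mem_iff_commute.mp
      (hHN (commutator_mem_commutator ((closure_le H).mpr hT hx) (mem_top y)))
    rw [← QuotientGroup.eq_one_iff] at ihx ihy ⊢
    calc ((x : F ⧸ N) * y) ^ n = x ^ n * y ^ n := hc.mul_pow n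
      _ = 1 := by rw [← QuotientGroup.mk_pow, ← QuotientGroup.mk_pow, ihx, ihy, one_mul]
  | inv x _ ihx => rw [inv_pow]; exact N.inv_mem ihx

end Commutators

/-! ### Basic commutators generate the factors of the lower central series -/

section BasicCommutators

variable {α : Type*}

theorem length_mul (u v : FreeMagma α) : (u * v).length = u.length + v.length := rfl

theorem finite_setOf_length_le [Finite α] (n : ℕ) : {b : FreeMagma α | b.length ≤ n}.Finite := by
  induction n with
  | zero =>
    refine Set.Finite.subset Set.finite_empty fun b hb => ?_
    have := b.length_pos
    simp only [Set.mem_ofPred_eq] at hb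
    omega
  | succ n ih =>
    refine ((Set.finite_range FreeMagma.of).union (Set.Finite.image2 (· * ·) ih ih)).subset ?_
    intro b hb
    cases b with
    | of a => exact Or.inl ⟨a, rfl⟩
    | mul u v =>
      have hu := u.length_pos
      have hv := v.length_pos
      change u.length + v.length ≤ n + 1 at hb
      refine Or.inr ⟨u, ?_, v, ?_, rfl⟩ <;> simp only [Set.mem_ofPred_eq] <;> omega

variable {F : Type*} [Group F] (x : α → F)

/-- The value of a formal bracket in a group, the letters being evaluated by `x`. -/
def groupBracket : FreeMagma α → F
  | .of a => x a
  | .mul u v => ⁅groupBracket u, groupBracket v⁆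

theorem groupBracket_of (a : α) : groupBracket x (.of a) = x a := rfl

theorem groupBracket_mul (u v : FreeMagma α) :
    groupBracket x (u * v) = ⁅groupBracket x u, groupBracket x v⁆ := rfl

theorem groupBracket_mem (b : FreeMagma α) : groupBracket x b ∈ weightSeries F b.length := by
  induction b with
  | ih1 a => exact mem_top _
  | ih2 u v hu hv => exact commutator_mem_weightSeries hu hv le_rfl

variable [LinearOrder (FreeMagma α)]

/-- The basic commutators of weight `n`. -/
def basicCommutators (α : Type*) [LinearOrder (FreeMagma α)] (n : ℕ) : Set (FreeMagma α) :=
  {b | IsBasicCommutator b ∧ b.length = n}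

theorem finite_basicCommutators [Finite α] (n : ℕ) : (basicCommutators α n).Finite :=
  (finite_setOf_length_le n).subset fun _ hb => hb.2.le

/-- The subgroup generated by the values of the basic commutators of weight `n`, together with
`γ_{n+1}`. It turns out to be all of `γ_n` when `x` generates the group. -/
def basicSubgroup (n : ℕ) : Subgroup F :=
  closure (groupBracket x '' basicCommutators α n ∪ weightSeries F (n + 1))

theorem weightSeries_le_basicSubgroup (n : ℕ) :
    weightSeries F (n + 1) ≤ basicSubgroup x n := fun _ h => subset_closure (Or.inr h)

theorem groupBracket_mem_basicSubgroup {b : FreeMagma α} (hb : IsBasicCommutator b) :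
    groupBracket x b ∈ basicSubgroup x b.length :=
  subset_closure (Or.inl ⟨b, ⟨hb, rfl⟩, rfl⟩)

theorem basicSubgroup_le (n : ℕ) : basicSubgroup x n ≤ weightSeries F n := by
  refine (closure_le _).mpr (Set.union_subset ?_ (weightSeries_antitone n.le_succ))
  rintro _ ⟨b, hb, rfl⟩
  exact hb.2 ▸ groupBracket_mem x b

theorem basicSubgroup_normal {n : ℕ} (hn : 1 ≤ n) : (basicSubgroup x n).Normal := by
  rw [← commutator_top_right_le_iff]
  refine (commutator_mono (basicSubgroup_le x n) le_rfl).trans ?_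
  rw [commutator_weightSeries_top hn]
  exact weightSeries_le_basicSubgroup x n

/-- The bracket of two basic commutators is, modulo terms of larger weight, a product of basic
commutators and their inverses. If `[u, v]` with `u = [u₁, u₂]` is not itself basic, then
`v < u₂`, and the Jacobi identity replaces it by brackets `[w, u₂]` and `[w, u₁]` with `w` basic
and `v < w`: both entries are larger than `v`, so induction on the smaller entry, downwards,
applies. -/
theorem commutator_groupBracket_mem [Finite α]
    (hord : ∀ a b : FreeMagma α, a.length < b.length → a < b) {u v : FreeMagma α}
    (hu : IsBasicCommutator u) (hv : IsBasicCommutator v) :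
    ⁅groupBracket x u, groupBracket x v⁆ ∈ basicSubgroup x (u.length + v.length) := by
  induction hn : u.length + v.length using Nat.strong_induction_on generalizing u v with
  | _ n ihn =>
  -- The number of brackets above `v` that matter is finite and serves as the inner measure.
  let U : FreeMagma α → Set (FreeMagma α) := fun v => {w | w.length ≤ n ∧ v < w}
  have hUfin : ∀ v, (U v).Finite := fun v => (finite_setOf_length_le n).subset fun w hw => hw.1
  -- By antisymmetry it is enough to treat the case `v < u`.
  suffices H : ∀ m : ℕ, ∀ u v : FreeMagma α, IsBasicCommutator u → IsBasicCommutator v → v < u →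
      u.length + v.length = n → (U v).ncard = m →
      ⁅groupBracket x u, groupBracket x v⁆ ∈ basicSubgroup x n by
    rcases lt_trichotomy u v with h | rfl | h
    · rw [commutatorElement_mem_comm]
      exact H _ v u hv hu h (by omega) rfl
    · rw [commutatorElement_self]
      exact one_mem _
    · exact H _ u v hu hv h hn rfl
  clear hu hv hn u v
  intro m
  induction m using Nat.strong_induction_on with
  | _ m ihm =>
  intro u v hu hv hvu hn hm
  have hupos := u.length_pos
  have hvpos := v.length_pos
  have hnormal : (basicSubgroup x n).Normal := basicSubgroup_normal x (by omega)
  by_cases hb : IsBasicCommutator (u * v)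
  · have := groupBracket_mem_basicSubgroup x hb
    rwa [length_mul, hn] at this
  cases hu with
  | of a => exact absurd (.mul _ _ (.of a) hv hvu fun u₁ u₂ h => by cases h) hb
  | mul u₁ u₂ hu₁ hu₂ hlt h =>
  have hvu₂ : v < u₂ := by
    by_contra hle
    refine hb (.mul _ _ (.mul _ _ hu₁ hu₂ hlt h) hv hvu fun a b hab => ?_)
    cases hab
    exact not_lt.mp hle
  rw [length_mul] at hn
  have h₁pos := u₁.length_pos
  have h₂pos := u₂.length_pos
  -- The inner induction hypothesis, for two basic commutators above `v`, in any order.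
  have key : ∀ w z : FreeMagma α, IsBasicCommutator w → IsBasicCommutator z → v < w → v < z →
      w.length + z.length = n → ⁅groupBracket x w, groupBracket x z⁆ ∈ basicSubgroup x n := by
    have hcard : ∀ z, z.length ≤ n → v < z → (U z).ncard < m := fun z hz hvz => by
      rw [← hm]
      exact Set.ncard_lt_ncard ⟨fun y hy => ⟨hy.1, hvz.trans hy.2⟩,
        fun hsub => lt_irrefl z (hsub (⟨hz, hvz⟩ : z ∈ U v)).2⟩ (hUfin v)
    intro w z hw hz hvw hvz hwz
    rcases lt_trichotomy w z with h | rfl | h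
    · rw [commutatorElement_mem_comm]
      exact ihm _ (hcard w (by omega) hvw) z w hz hw h (by omega) rfl
    · rw [commutatorElement_self]
      exact one_mem _
    · exact ihm _ (hcard z (by omega) hvz) w z hw hz h hwz rfl
  have expand : ∀ a b : FreeMagma α, IsBasicCommutator a → IsBasicCommutator b →
      a.length + v.length + b.length = n → v < b →
      ⁅⁅groupBracket x a, groupBracket x v⁆, groupBracket x b⁆ ∈ basicSubgroup x n := by
    intro a b ha hb hab hvb
    have hapos := a.length_pos
    have hbpos := b.length_pos
    refine commutator_mem_of_mem_closure ?_ (ihn (a.length + v.length) (by omega) ha hv rfl)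
    rintro _ (⟨w, ⟨hw, hwl⟩, rfl⟩ | ht)
    · exact key w b hw hb (hord _ _ (by omega)) hvb (by omega)
    · exact weightSeries_le_basicSubgroup x n
        (commutator_mem_weightSeries ht (groupBracket_mem x b) (by omega))
  rw [groupBracket_mul]
  refine commutatorElement_commutatorElement_mem (groupBracket_mem x u₁) (groupBracket_mem x u₂)
    (groupBracket_mem x v) h₁pos h₂pos hvpos ?_ (expand u₁ u₂ hu₁ hu₂ (by omega) hvu₂)
    (expand u₂ u₁ hu₂ hu₁ (by omega) (hvu₂.trans hlt))
  rw [hn]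
  exact weightSeries_le_basicSubgroup x n

/-- The basic commutators of weight `n` generate `γ_n` modulo `γ_{n+1}`. -/
theorem weightSeries_le_basicSubgroup_self [Finite α]
    (hord : ∀ a b : FreeMagma α, a.length < b.length → a < b)
    (hx : closure (Set.range x) = ⊤) {n : ℕ} (hn : 1 ≤ n) :
    weightSeries F n ≤ basicSubgroup x n := by
  induction n, hn using Nat.le_induction with
  | base =>
    refine le_top.trans (hx ▸ (closure_le _).mpr ?_)
    rintro _ ⟨a, rfl⟩
    exact groupBracket_mem_basicSubgroup x (b := .of a) (.of a)
  | succ n hn ih =>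
    have := basicSubgroup_normal x (Nat.le_add_left 1 n)
    rw [← commutator_weightSeries_top hn, commutator_le]
    intro w hw f _
    refine commutator_mem_of_mem_closure ?_ (ih hw)
    rintro _ (⟨b, ⟨hb, hbl⟩, rfl⟩ | ht)
    · rw [commutatorElement_mem_comm]
      refine commutator_mem_of_mem_closure ?_ (hx ▸ mem_top f)
      rintro _ ⟨a, rfl⟩
      rw [commutatorElement_mem_comm]
      have h := commutator_groupBracket_mem x hord hb (v := .of a) (.of a)
      rw [hbl] at h
      exact h
    · refine weightSeries_le_basicSubgroup x _ ?_
      rw [← commutator_weightSeries_top (Nat.le_add_left 1 n)]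
      exact commutator_mem_commutator ht (mem_top f)

end BasicCommutators

/-! ### The Magnus homomorphism -/

section Magnus

open PowerSeries

variable {A : Type*} [Ring A]

/-- The power series `1 + a t` as a unit, with inverse `∑ (-a) ^ n t ^ n`. -/
noncomputable def oneAddUnit (a : A) : A⟦X⟧ˣ where
  val := 1 + C a * X
  inv := mk fun n => (-a) ^ n
  val_inv := by
    ext n
    rcases n with _ | n
    · simp [add_mul, mul_assoc]
    · rw [add_mul, one_mul, map_add, mul_assoc, coeff_C_mul, coeff_succ_X_mul]
      simp [pow_succ', coeff_one]
  inv_val := by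
    ext n
    rcases n with _ | n
    · simp [mul_add, ← mul_assoc]
    · rw [mul_add, mul_one, map_add, ← mul_assoc, coeff_succ_mul_X, coeff_mul_C]
      simp [pow_succ, coeff_one]

theorem X_pow_dvd_mul_left {n : ℕ} {p : A⟦X⟧} (h : X ^ n ∣ p) (q : A⟦X⟧) : X ^ n ∣ q * p := by
  obtain ⟨c, rfl⟩ := h
  exact ⟨q * c, by rw [← mul_assoc, ← X_pow_mul, mul_assoc]⟩

/-- The group of the invertible power series congruent to `1` modulo `t ^ n`. -/
def congruenceSubgroup (A : Type*) [Ring A] (n : ℕ) : Subgroup A⟦X⟧ˣ where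
  carrier := {u | X ^ n ∣ (u : A⟦X⟧) - 1}
  one_mem' := by simp
  mul_mem' {u v} hu hv := by
    have e : ((u * v : A⟦X⟧ˣ) : A⟦X⟧) - 1 = u * (v - 1) + (u - 1) := by
      push_cast; noncomm_ring
    simp only [Set.mem_ofPred_eq] at *
    rw [e]
    exact dvd_add (X_pow_dvd_mul_left hv _) hu
  inv_mem' {u} hu := by
    have e : ((u⁻¹ : A⟦X⟧ˣ) : A⟦X⟧) - 1 = -((u⁻¹ : A⟦X⟧ˣ) * (u - 1)) := by
      rw [mul_sub, Units.inv_mul]; noncomm_ring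
    simp only [Set.mem_ofPred_eq] at *
    rw [e]
    exact (X_pow_dvd_mul_left hu _).neg_right

theorem mem_congruenceSubgroup_iff {n : ℕ} {u : A⟦X⟧ˣ} :
    u ∈ congruenceSubgroup A n ↔ ∃ a : A⟦X⟧, (u : A⟦X⟧) = 1 + X ^ n * a := by
  simp only [← sub_eq_iff_eq_add']
  rfl

theorem congruenceSubgroup_antitone : Antitone (congruenceSubgroup A) := fun _ _ h _ hu =>
  (pow_dvd_pow _ h).trans hu

theorem oneAddUnit_mem (a : A) : oneAddUnit a ∈ congruenceSubgroup A 1 :=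
  mem_congruenceSubgroup_iff.mpr ⟨C a, by rw [pow_one, X_mul]; rfl⟩

theorem coeff_one_oneAddUnit (a : A) : coeff 1 (oneAddUnit a : A⟦X⟧) = a := by
  simp [oneAddUnit, coeff_one]

theorem coeff_one_add_X_pow_mul {n : ℕ} (hn : 1 ≤ n) (a : A⟦X⟧) :
    coeff n (1 + X ^ n * a) = constantCoeff a := by
  have := coeff_X_pow_mul a n 0
  rw [zero_add] at this
  rw [map_add, this, coeff_one, if_neg (by omega), zero_add, coeff_zero_eq_constantCoeff]

theorem constantCoeff_of_mem {u : A⟦X⟧ˣ} (hu : u ∈ congruenceSubgroup A 1) :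
    constantCoeff (u : A⟦X⟧) = 1 := by
  obtain ⟨a, ha⟩ := mem_congruenceSubgroup_iff.mp hu
  simp [ha]

theorem commutator_eq_of_eq {i j : ℕ} {u v : A⟦X⟧ˣ} {a b : A⟦X⟧}
    (hu : (u : A⟦X⟧) = 1 + X ^ i * a) (hv : (v : A⟦X⟧) = 1 + X ^ j * b) :
    ((⁅u, v⁆ : A⟦X⟧ˣ) : A⟦X⟧) =
      1 + X ^ (i + j) * ((a * b - b * a) * ((u⁻¹ * v⁻¹ : A⟦X⟧ˣ) : A⟦X⟧)) := by
  have h : (u * v - v * u : A⟦X⟧) = X ^ (i + j) * (a * b - b * a) := by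
    have h₁ : X ^ i * a * (X ^ j * b) = X ^ (i + j) * (a * b) := by
      rw [mul_assoc, ← mul_assoc a, ← X_pow_mul, pow_add, mul_assoc, mul_assoc]
    have h₂ : X ^ j * b * (X ^ i * a) = X ^ (i + j) * (b * a) := by
      rw [mul_assoc, ← mul_assoc b, ← X_pow_mul, add_comm, pow_add, mul_assoc, mul_assoc]
    rw [mul_sub, ← h₁, ← h₂, hu, hv]
    noncomm_ring
  have e : ⁅u, v⁆ = u * v * (u⁻¹ * v⁻¹) := by simp [commutatorElement_def, mul_assoc]
  have e' : (v * u : A⟦X⟧) * ((u⁻¹ * v⁻¹ : A⟦X⟧ˣ) : A⟦X⟧) = 1 := by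
    rw [← Units.val_mul, ← Units.val_mul]
    simp [mul_assoc]
  rw [← mul_assoc, ← h, sub_mul, e', e]
  push_cast
  noncomm_ring

theorem commutator_mem_congruenceSubgroup {i j : ℕ} {u v : A⟦X⟧ˣ}
    (hu : u ∈ congruenceSubgroup A i) (hv : v ∈ congruenceSubgroup A j) :
    ⁅u, v⁆ ∈ congruenceSubgroup A (i + j) := by
  obtain ⟨a, ha⟩ := mem_congruenceSubgroup_iff.mp hu
  obtain ⟨b, hb⟩ := mem_congruenceSubgroup_iff.mp hv
  exact mem_congruenceSubgroup_iff.mpr ⟨_, commutator_eq_of_eq ha hb⟩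

instance congruenceSubgroup_normal (n : ℕ) : (congruenceSubgroup A n).Normal where
  conj_mem u hu g := by
    have h : ⁅g, u⁆ ∈ congruenceSubgroup A (0 + n) :=
      commutator_mem_congruenceSubgroup (i := 0) (by simp [mem_congruenceSubgroup_iff,
        ← sub_eq_iff_eq_add']) hu
    rw [zero_add] at h
    simpa [commutatorElement_def] using mul_mem h hu

/-- Group commutators induce ring commutators on leading coefficients. -/
theorem coeff_commutator {i j : ℕ} (hi : 1 ≤ i) (hj : 1 ≤ j) {u v : A⟦X⟧ˣ}
    (hu : u ∈ congruenceSubgroup A i) (hv : v ∈ congruenceSubgroup A j) :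
    coeff (i + j) ((⁅u, v⁆ : A⟦X⟧ˣ) : A⟦X⟧) =
      coeff i (u : A⟦X⟧) * coeff j (v : A⟦X⟧) - coeff j (v : A⟦X⟧) * coeff i (u : A⟦X⟧) := by
  obtain ⟨a, ha⟩ := mem_congruenceSubgroup_iff.mp hu
  obtain ⟨b, hb⟩ := mem_congruenceSubgroup_iff.mp hv
  have huv : u⁻¹ * v⁻¹ ∈ congruenceSubgroup A 1 :=
    mul_mem (inv_mem (congruenceSubgroup_antitone hi hu))
      (inv_mem (congruenceSubgroup_antitone hj hv))
  rw [commutator_eq_of_eq ha hb, ha, hb, coeff_one_add_X_pow_mul (by omega),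
    coeff_one_add_X_pow_mul hi, coeff_one_add_X_pow_mul hj, map_mul, constantCoeff_of_mem huv]
  simp

theorem coeff_mul_of_mem {n : ℕ} (hn : 1 ≤ n) {u v : A⟦X⟧ˣ}
    (hu : u ∈ congruenceSubgroup A n) (hv : v ∈ congruenceSubgroup A n) :
    coeff n ((u * v : A⟦X⟧ˣ) : A⟦X⟧) = coeff n (u : A⟦X⟧) + coeff n (v : A⟦X⟧) := by
  obtain ⟨a, ha⟩ := mem_congruenceSubgroup_iff.mp hu
  obtain ⟨b, hb⟩ := mem_congruenceSubgroup_iff.mp hv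
  have e : ((u * v : A⟦X⟧ˣ) : A⟦X⟧) = 1 + X ^ n * (a + b + a * X ^ n * b) := by
    rw [Units.val_mul, ha, hb]
    noncomm_ring
  have hX : constantCoeff (X ^ n : A⟦X⟧) = 0 := by
    rw [map_pow, constantCoeff_X, zero_pow (by omega)]
  rw [e, ha, hb, coeff_one_add_X_pow_mul hn, coeff_one_add_X_pow_mul hn,
    coeff_one_add_X_pow_mul hn]
  simp [hX]

/-- The leading coefficient, as a homomorphism from the group of the power series congruent to
`1` modulo `t ^ n` to the additive group of `A`. -/
noncomputable def leadingCoeffHom {n : ℕ} (hn : 1 ≤ n) :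
    congruenceSubgroup A n →* Multiplicative A where
  toFun u := .ofAdd (coeff n ((u : A⟦X⟧ˣ) : A⟦X⟧))
  map_one' := by
    simp [coeff_one, show n ≠ 0 by omega]
  map_mul' u v := by
    rw [← ofAdd_add, ← coeff_mul_of_mem hn u.2 v.2]
    rfl

theorem coeff_eq_zero_of_mem_succ {n : ℕ} (hn : 1 ≤ n) {u : A⟦X⟧ˣ}
    (hu : u ∈ congruenceSubgroup A (n + 1)) : coeff n (u : A⟦X⟧) = 0 := by
  obtain ⟨a, ha⟩ := mem_congruenceSubgroup_iff.mp hu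
  rw [ha, pow_succ, mul_assoc, coeff_one_add_X_pow_mul hn]
  simp

theorem mem_succ_of_coeff_eq_zero {n : ℕ} (hn : 1 ≤ n) {u : A⟦X⟧ˣ}
    (hu : u ∈ congruenceSubgroup A n) (h : coeff n (u : A⟦X⟧) = 0) :
    u ∈ congruenceSubgroup A (n + 1) := by
  obtain ⟨a, ha⟩ := mem_congruenceSubgroup_iff.mp hu
  rw [ha, coeff_one_add_X_pow_mul hn, ← X_dvd_iff] at h
  obtain ⟨b, rfl⟩ := h
  exact mem_congruenceSubgroup_iff.mpr ⟨b, by rw [ha, pow_succ, mul_assoc]⟩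

theorem coeff_pow_of_mem {n : ℕ} (hn : 1 ≤ n) {u : A⟦X⟧ˣ} (hu : u ∈ congruenceSubgroup A n)
    (k : ℕ) : coeff n ((u ^ k : A⟦X⟧ˣ) : A⟦X⟧) = k * coeff n (u : A⟦X⟧) := by
  have := congrArg Multiplicative.toAdd 
    (map_pow (leadingCoeffHom (A := A) hn) ⟨u, hu⟩ k)
  rw [toAdd_pow, nsmul_eq_mul] at this
  exact this

variable {α : Type*} (e : α → A)

/-- The Magnus homomorphism, with `a ↦ 1 + e a * t`. -/
noncomputable def magnus : FreeGroup α →* A⟦X⟧ˣ :=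
  FreeGroup.lift fun a => oneAddUnit (e a)

theorem magnus_mem (w : FreeGroup α) : magnus e w ∈ congruenceSubgroup A 1 := by
  induction w using FreeGroup.induction_on with
  | C1 => simp
  | of a => simpa [magnus] using oneAddUnit_mem (e a)
  | inv_of a h => rw [map_inv]; exact inv_mem h
  | mul v w hv hw => rw [map_mul]; exact mul_mem hv hw

theorem magnus_mem_of_mem_iterCommutator {R : Subgroup (FreeGroup α)} {j : ℕ}
    (hR : R ≤ (congruenceSubgroup A j).comap (magnus e)) (i : ℕ) :
    iterCommutator R i ≤ (congruenceSubgroup A (j + i)).comap (magnus e) := by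
  induction i with
  | zero => exact hR
  | succ i ih =>
    refine commutator_le.mpr fun u hu v _ => ?_
    rw [mem_comap, map_commutatorElement, ← add_assoc]
    exact commutator_mem_congruenceSubgroup (i := j + i) (ih hu) (magnus_mem e v)

theorem weightSeries_le_comap_magnus {n : ℕ} (hn : 1 ≤ n) :
    weightSeries (FreeGroup α) n ≤ (congruenceSubgroup A n).comap (magnus e) := by
  have h := magnus_mem_of_mem_iterCommutator (R := ⊤) e (fun w _ => magnus_mem e w) (n - 1)
  rwa [iterCommutator_top, Nat.add_sub_cancel' hn] at h

/-- The value of a formal bracket in an associative ring, the letters being evaluated by `e`. -/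
def ringBracket : FreeMagma α → A
  | .of a => e a
  | .mul u v => ringBracket u * ringBracket v - ringBracket v * ringBracket u

theorem ringBracket_mul (u v : FreeMagma α) : ringBracket e (u * v) =
    ringBracket e u * ringBracket e v - ringBracket e v * ringBracket e u := rfl

theorem coeff_magnus_groupBracket (b : FreeMagma α) :
    coeff b.length (magnus e (groupBracket FreeGroup.of b) : A⟦X⟧) = ringBracket e b := by
  induction b with
  | ih1 a =>
    rw [groupBracket_of, magnus, FreeGroup.lift_apply_of]
    exact coeff_one_oneAddUnit (e a)
  | ih2 u v hu hv =>
    have h := fun b : FreeMagma α => weightSeries_le_comap_magnus e b.length_pos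
      (groupBracket_mem FreeGroup.of b)
    rw [groupBracket_mul, map_commutatorElement, length_mul,
      coeff_commutator u.length_pos v.length_pos (h u) (h v), hu, hv, ringBracket_mul]

/-- The ring commutator of two basic commutators is an integral combination of basic commutators:
the leading coefficient of the corresponding statement in the free group. -/
theorem ringBracket_commutator_mem [LinearOrder (FreeMagma α)] [Finite α]
    (hord : ∀ a b : FreeMagma α, a.length < b.length → a < b) {u v : FreeMagma α}
    (hu : IsBasicCommutator u) (hv : IsBasicCommutator v) :
    ringBracket e (u * v) ∈
      AddSubgroup.closure (ringBracket e '' basicCommutators α (u.length + v.length)) := by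
  have h := commutator_groupBracket_mem FreeGroup.of hord hu hv
  rw [← coeff_magnus_groupBracket, length_mul, groupBracket_mul]
  have hn : 1 ≤ u.length + v.length := u.length_pos.trans_le (Nat.le_add_right _ _)
  generalize u.length + v.length = n at *
  generalize ⁅groupBracket FreeGroup.of u, groupBracket FreeGroup.of v⁆ = w at h
  have hle : basicSubgroup FreeGroup.of n ≤ (congruenceSubgroup A n).comap (magnus e) :=
    (basicSubgroup_le FreeGroup.of n).trans (weightSeries_le_comap_magnus e hn)
  induction h using closure_induction with
  | mem w hw =>
    rcases hw with ⟨b, hb, rfl⟩ | hw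
    · refine AddSubgroup.subset_closure ⟨b, hb, ?_⟩
      rw [← coeff_magnus_groupBracket, hb.2]
    · rw [coeff_eq_zero_of_mem_succ hn (weightSeries_le_comap_magnus e (by omega) hw)]
      exact zero_mem _
  | one =>
    rw [map_one, Units.val_one, coeff_one, if_neg (by omega)]
    exact zero_mem _
  | mul w z hw hz ihw ihz =>
    rw [map_mul, coeff_mul_of_mem hn (hle hw) (hle hz)]
    exact add_mem ihw ihz
  | inv w hw ihw =>
    have h := coeff_mul_of_mem hn (hle hw) (hle (inv_mem hw))
    rw [← map_mul, mul_inv_cancel, map_one, Units.val_one, coeff_one, if_neg (by omega)] at h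
    rw [eq_neg_of_add_eq_zero_right h.symm]
    exact neg_mem ihw

end Magnus

/-! ### Linear independence of the basic commutators in the free algebra -/

section Words

variable {α : Type*}

/-- The word obtained from a formal bracket by deleting the brackets. -/
def foliage : FreeMagma α → List α
  | .of a => [a]
  | .mul u v => foliage u ++ foliage v

theorem foliage_mul (u v : FreeMagma α) : foliage (u * v) = foliage u ++ foliage v := rfl

theorem length_foliage (b : FreeMagma α) : (foliage b).length = b.length := by
  induction b with
  | ih1 a => rfl
  | ih2 u v hu hv => rw [foliage_mul, List.length_append, hu, hv, length_mul]

/-- The total weight of a list of formal brackets. -/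
def totalWeight (l : List (FreeMagma α)) : ℕ := (l.map FreeMagma.length).sum

theorem totalWeight_cons (b : FreeMagma α) (l : List (FreeMagma α)) :
    totalWeight (b :: l) = b.length + totalWeight l := by
  simp [totalWeight]

theorem totalWeight_perm {l l' : List (FreeMagma α)} (h : l.Perm l') :
    totalWeight l = totalWeight l' := (h.map _).sum_eq

theorem length_flatMap_foliage (l : List (FreeMagma α)) :
    (l.flatMap foliage).length = totalWeight l := by
  induction l with
  | nil => rfl
  | cons b l ih => rw [List.flatMap_cons, List.length_append, ih, length_foliage, totalWeight_cons]

variable [LinearOrder (FreeMagma α)]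

/-- One step of the collecting process: put `u` in front of a list, bracketing it with the entries
that it meets as long as these are smaller. -/
def collectInto : FreeMagma α → List (FreeMagma α) → List (FreeMagma α)
  | u, [] => [u]
  | u, h :: t => if u ≤ h then u :: h :: t else collectInto (u * h) t

/-- The collecting process, for the letters of a word from right to left. -/
def collect (w : List α) (l : List (FreeMagma α)) : List (FreeMagma α) :=
  w.foldr (fun a => collectInto (.of a)) l

theorem collectInto_of_forall_le {u : FreeMagma α} {l : List (FreeMagma α)}
    (h : ∀ b ∈ l, u ≤ b) : collectInto u l = u :: l := by
  cases l with
  | nil => rfl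
  | cons b l => exact if_pos (h b List.mem_cons_self)

theorem collectInto_cons_of_lt {u v : FreeMagma α} (h : v < u) (l : List (FreeMagma α)) :
    collectInto u (v :: l) = collectInto (u * v) l := if_neg h.not_ge

/-- Collecting the word of a basic commutator `b` rebuilds `b`. The condition on `l` is what a
second entry of `b` needs so that it is not itself bracketed with an entry of `l`. -/
theorem collect_foliage (hord : ∀ a b : FreeMagma α, a.length < b.length → a < b)
    {b : FreeMagma α} (hb : IsBasicCommutator b) {l : List (FreeMagma α)}
    (h : ∀ u v, b = u * v → ∀ c ∈ l, v ≤ c) : collect (foliage b) l = collectInto b l := by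
  induction hb generalizing l with
  | of a => rfl
  | mul u v hu hv hvu hr ihu ihv =>
    have hvl : ∀ c ∈ l, v ≤ c := h u v rfl
    have hv' : collect (foliage v) l = v :: l := by
      rw [ihv, collectInto_of_forall_le hvl]
      rintro v₁ v₂ rfl c hc
      have hlt : v₂ < v₁ * v₂ := hord _ _ (by have := v₁.length_pos; rw [length_mul]; omega)
      exact hlt.le.trans (hvl c hc)
    rw [foliage_mul, collect, List.foldr_append, ← collect, ← collect, hv', ihu,
      collectInto_cons_of_lt hvu]
    intro u₁ u₂ hu c hc
    rcases List.mem_cons.mp hc with rfl | hc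
    · exact hr u₁ u₂ hu
    · exact (hr u₁ u₂ hu).trans (hvl c hc)

/-- A nondecreasing list of basic commutators is recovered from its underlying word by the
collecting process. -/
theorem collect_flatMap_foliage (hord : ∀ a b : FreeMagma α, a.length < b.length → a < b)
    {l : List (FreeMagma α)} (hb : ∀ b ∈ l, IsBasicCommutator b) (hl : l.Pairwise (· ≤ ·)) :
    collect (l.flatMap foliage) [] = l := by
  induction l with
  | nil => rfl
  | cons b l ih =>
    rw [List.pairwise_cons] at hl
    rw [List.flatMap_cons, collect, List.foldr_append, ← collect, ← collect,
      ih (fun c hc => hb c (List.mem_cons_of_mem _ hc)) hl.2,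
      collect_foliage hord (hb b List.mem_cons_self), collectInto_of_forall_le hl.1]
    rintro u v rfl c hc
    have hlt : v < u * v := hord _ _ (by have := u.length_pos; rw [length_mul]; omega)
    exact hlt.le.trans (hl.1 c hc)

/-- The nondecreasing lists of basic commutators of total weight `n`. -/
def sortedBasicLists (α : Type*) [LinearOrder (FreeMagma α)] (n : ℕ) :
    Set (List (FreeMagma α)) :=
  {l | (∀ b ∈ l, IsBasicCommutator b) ∧ l.Pairwise (· ≤ ·) ∧ totalWeight l = n}

theorem injOn_flatMap_foliage (hord : ∀ a b : FreeMagma α, a.length < b.length → a < b) (n : ℕ) :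
    Set.InjOn (fun l : List (FreeMagma α) => l.flatMap foliage) (sortedBasicLists α n) :=
  fun l hl l' hl' h => by
    rw [← collect_flatMap_foliage hord hl.1 hl.2.1, ← collect_flatMap_foliage hord hl'.1 hl'.2.1]
    exact congrArg (collect · []) h

end Words

section Straightening

variable {α : Type*} [LinearOrder (FreeMagma α)] [Finite α]
  (k : Type*) [CommRing k] {A : Type*} [Ring A] [Algebra k A] (e : α → A)

/-- The value of a list of formal brackets: the product of the values of its entries. -/
def bracketProd (l : List (FreeMagma α)) : A := (l.map (ringBracket e)).prod

omit [LinearOrder (FreeMagma α)] [Finite α] in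
theorem bracketProd_cons (b : FreeMagma α) (l : List (FreeMagma α)) :
    bracketProd e (b :: l) = ringBracket e b * bracketProd e l := by
  simp [bracketProd]

/-- The span of the products of fewer than `m` basic commutators, in any order, of total
weight `n`. -/
def shortProducts (n m : ℕ) : Submodule k A :=
  Submodule.span k (bracketProd e ''
    {l | (∀ b ∈ l, IsBasicCommutator b) ∧ totalWeight l = n ∧ l.length < m})

omit [Finite α] in
theorem ringBracket_mul_mem_shortProducts {b : FreeMagma α} (hb : IsBasicCommutator b) {n m : ℕ}
    {p : A} (hp : p ∈ shortProducts k e n m) :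
    ringBracket e b * p ∈ shortProducts k e (b.length + n) (m + 1) := by
  induction hp using Submodule.span_induction with
  | mem p hp =>
    obtain ⟨l, ⟨hl, hn, hm⟩, rfl⟩ := hp
    refine Submodule.subset_span ⟨b :: l, ⟨?_, ?_, ?_⟩, bracketProd_cons e b l⟩
    · exact List.forall_mem_cons.mpr ⟨hb, hl⟩
    · rw [totalWeight_cons, hn]
    · simpa using hm
  | zero => simp
  | add x y _ _ hx hy => rw [mul_add]; exact add_mem hx hy
  | smul c x _ hx => rw [mul_smul_comm]; exact Submodule.smul_mem _ _ hx

/-- Permuting the factors changes a product of basic commutators by a combination of shorter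
products. -/
theorem bracketProd_sub_mem_of_perm
    (hord : ∀ a b : FreeMagma α, a.length < b.length → a < b) {l l' : List (FreeMagma α)}
    (h : l.Perm l') (hl : ∀ b ∈ l, IsBasicCommutator b) :
    bracketProd e l - bracketProd e l' ∈ shortProducts k e (totalWeight l) l.length := by
  induction h with
  | nil => simp
  | cons b h ih =>
    rw [List.forall_mem_cons] at hl
    rw [bracketProd_cons, bracketProd_cons, ← mul_sub, totalWeight_cons]
    exact ringBracket_mul_mem_shortProducts k e hl.1 (ih hl.2)
  | swap u v l =>
    simp only [List.forall_mem_cons] at hl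
    obtain ⟨hv, hu, hl⟩ := hl
    simp only [bracketProd_cons]
    rw [← mul_assoc, ← mul_assoc, ← sub_mul, ← ringBracket_mul]
    have h := ringBracket_commutator_mem e hord hv hu
    generalize ringBracket e (v * u) = q at h
    induction h using AddSubgroup.closure_induction with
    | mem q hq =>
      obtain ⟨b, hb, rfl⟩ := hq
      refine Submodule.subset_span ⟨b :: l, ⟨?_, ?_, ?_⟩, bracketProd_cons e b l⟩
      · exact List.forall_mem_cons.mpr ⟨hb.1, hl⟩
      · rw [totalWeight_cons, totalWeight_cons, totalWeight_cons, hb.2, add_assoc]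
      · simp
    | zero => simp
    | add x y _ _ hx hy => rw [add_mul]; exact add_mem hx hy
    | neg x _ hx => rw [neg_mul]; exact neg_mem hx
  | trans h₁ h₂ ih₁ ih₂ =>
    have h₃ := ih₂ fun b hb => hl b (h₁.mem_iff.mpr hb)
    rw [← totalWeight_perm h₁, ← h₁.length_eq] at h₃
    simpa using add_mem (ih₁ hl) h₃

/-- Straightening: sort the factors, and treat the shorter products that arise by induction on the
number of factors. -/
theorem bracketProd_mem_span_sorted
    (hord : ∀ a b : FreeMagma α, a.length < b.length → a < b) (l : List (FreeMagma α))
    (hl : ∀ b ∈ l, IsBasicCommutator b) :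
    bracketProd e l ∈
      Submodule.span k (bracketProd e '' sortedBasicLists α (totalWeight l)) := by
  induction hm : l.length using Nat.strong_induction_on generalizing l with
  | _ m ih =>
  have hp : (l.insertionSort (· ≤ ·)).Perm l := List.perm_insertionSort _ l
  have hlt : shortProducts k e (totalWeight l) m ≤
      Submodule.span k (bracketProd e '' sortedBasicLists α (totalWeight l)) := by
    refine Submodule.span_le.mpr ?_
    rintro _ ⟨l', ⟨hl', hw, hlen⟩, rfl⟩
    exact hw ▸ ih _ hlen l' hl' rfl
  have h := hlt (hm ▸ bracketProd_sub_mem_of_perm k e hord hp.symm hl)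
  have hs : bracketProd e (l.insertionSort (· ≤ ·)) ∈
      Submodule.span k (bracketProd e '' sortedBasicLists α (totalWeight l)) :=
    Submodule.subset_span ⟨_, ⟨fun b hb => hl b (hp.mem_iff.mp hb),
      List.pairwise_insertionSort _ l, totalWeight_perm hp⟩, rfl⟩
  exact (Submodule.sub_mem_iff_left _ hs).mp h

/-- The homogeneous component of degree `n` of the subalgebra generated by the letters. -/
def homogeneousPart (n : ℕ) : Submodule k A := Submodule.span k (Set.range e) ^ n

omit [LinearOrder (FreeMagma α)] [Finite α] in
theorem ringBracket_mem_homogeneousPart (b : FreeMagma α) :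
    ringBracket e b ∈ homogeneousPart k e b.length := by
  induction b with
  | ih1 a =>
    change e a ∈ Submodule.span k (Set.range e) ^ 1
    rw [pow_one]
    exact Submodule.subset_span ⟨a, rfl⟩
  | ih2 u v hu hv =>
    rw [ringBracket_mul, length_mul, homogeneousPart]
    refine sub_mem ?_ ?_
    · rw [pow_add]
      exact Submodule.mul_mem_mul hu hv
    · rw [add_comm, pow_add]
      exact Submodule.mul_mem_mul hv hu

omit [LinearOrder (FreeMagma α)] [Finite α] in
theorem bracketProd_mem_homogeneousPart (l : List (FreeMagma α)) :
    bracketProd e l ∈ homogeneousPart k e (totalWeight l) := by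
  induction l with
  | nil => simp [bracketProd, homogeneousPart, totalWeight, Submodule.one_le.mp le_rfl]
  | cons b l ih =>
    rw [bracketProd_cons, totalWeight_cons, homogeneousPart, pow_add]
    exact Submodule.mul_mem_mul (ringBracket_mem_homogeneousPart k e b) ih

omit [LinearOrder (FreeMagma α)] [Finite α] in
theorem bracketProd_map_of (w : List α) : bracketProd e (w.map .of) = (w.map e).prod := by
  simp only [bracketProd, List.map_map]
  rfl

omit [LinearOrder (FreeMagma α)] [Finite α] in
theorem totalWeight_map_of (w : List α) : totalWeight (w.map .of) = w.length := by
  induction w with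
  | nil => rfl
  | cons a w ih => rw [List.map_cons, totalWeight_cons, ih, List.length_cons, add_comm]; rfl

/-- The nondecreasing products of basic commutators of total weight `n` span the component of
degree `n`, because a word is itself a product of basic commutators, namely of letters. -/
theorem homogeneousPart_le_span_sorted
    (hord : ∀ a b : FreeMagma α, a.length < b.length → a < b) (n : ℕ) :
    homogeneousPart k e n ≤ Submodule.span k (bracketProd e '' sortedBasicLists α n) := by
  rw [homogeneousPart, Submodule.span_pow, Submodule.span_le]
  intro p hp
  obtain ⟨f, rfl⟩ := Set.mem_pow.mp hp
  choose g hg using fun i => (f i).2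
  have h := bracketProd_mem_span_sorted k e hord ((List.ofFn g).map .of) fun b hb => by
    obtain ⟨a, _, rfl⟩ := List.mem_map.mp hb
    exact .of a
  rw [bracketProd_map_of, totalWeight_map_of, List.length_ofFn, List.map_ofFn] at h
  have hfg : (fun i => (f i : A)) = e ∘ g := funext fun i => (hg i).symm
  rw [hfg]
  exact h

end Straightening

section LinearIndependence

variable {α : Type*} (k : Type*) [CommRing k]

theorem linearIndependent_words :
    LinearIndependent k fun w : List α => (w.map (FreeAlgebra.ι k)).prod := by
  have h : ∀ w : List α, FreeAlgebra.basisFreeMonoid k α (FreeMonoid.ofList w) =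
      (w.map (FreeAlgebra.ι k)).prod := fun w => by
    simp [FreeAlgebra.basisFreeMonoid, FreeAlgebra.equivMonoidAlgebraFreeMonoid,
      FreeMonoid.lift_apply]
  simp only [← h]
  exact (FreeAlgebra.basisFreeMonoid k α).linearIndependent.comp _ FreeMonoid.ofList.injective

variable [LinearOrder (FreeMagma α)] [Finite α]

/-- The nondecreasing products of basic commutators of total weight `n` are linearly independent
in the free algebra: they span its component of degree `n`, and there are at most as many of them
as words of length `n`, so the Orzech property applies. -/
theorem linearIndependent_bracketProd
    (hord : ∀ a b : FreeMagma α, a.length < b.length → a < b) (n : ℕ) :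
    LinearIndependent k fun l : sortedBasicLists α n =>
      bracketProd (FreeAlgebra.ι k) (l : List (FreeMagma α)) := by
  let e : α → FreeAlgebra k α := FreeAlgebra.ι k
  let M := homogeneousPart k e n
  have : Module.Finite k M := Module.Finite.iff_fg.mpr
    ((Submodule.fg_span (Set.finite_range e)).pow n)
  let f : sortedBasicLists α n → M := fun l =>
    ⟨bracketProd e l.1, by
      have h := bracketProd_mem_homogeneousPart k e l.1
      rwa [l.2.2.2] at h⟩
  let i : sortedBasicLists α n → M := fun l =>
    ⟨((l.1.flatMap foliage).map e).prod, by
      have h := bracketProd_mem_homogeneousPart k e ((l.1.flatMap foliage).map .of)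
      rwa [bracketProd_map_of, totalWeight_map_of, length_flatMap_foliage, l.2.2.2] at h⟩
  have hi : LinearIndependent k i := by
    refine .of_comp M.subtype ?_
    exact (linearIndependent_words k).comp _ (injOn_flatMap_foliage hord n).injective
  have hf : Function.Surjective (Finsupp.linearCombination k f) := by
    rw [← LinearMap.range_eq_top, Finsupp.range_linearCombination]
    refine Submodule.map_injective_of_injective M.subtype_injective ?_
    rw [Submodule.map_span, Submodule.map_top, Submodule.range_subtype, ← Set.range_comp]
    refine le_antisymm (Submodule.span_le.mpr ?_) ?_
    · rintro _ ⟨l, rfl⟩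
      exact (f l).2
    · refine (homogeneousPart_le_span_sorted k e hord n).trans (Submodule.span_mono ?_)
      rintro _ ⟨l, hl, rfl⟩
      exact ⟨⟨l, hl⟩, rfl⟩
  have hinj := OrzechProperty.injective_of_surjective_of_injective
    (Finsupp.linearCombination k i) (Finsupp.linearCombination k f) hi hf
  exact LinearIndependent.map' (v := f) hinj M.subtype
    (LinearMap.ker_eq_bot.mpr M.subtype_injective)

/-- The basic commutators of weight `n` are linearly independent in the free algebra, over any
commutative ring of coefficients. -/
theorem linearIndependent_ringBracket
    (hord : ∀ a b : FreeMagma α, a.length < b.length → a < b) (n : ℕ) :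
    LinearIndependent k fun b : basicCommutators α n =>
      ringBracket (FreeAlgebra.ι k) (b : FreeMagma α) := by
  let f : basicCommutators α n → sortedBasicLists α n := fun b =>
    ⟨[b.1], by simpa using b.2.1, by simp, by simpa [totalWeight] using b.2.2⟩
  have hf : Function.Injective f := fun b c h => by
    simpa [f, Subtype.ext_iff] using h
  convert (linearIndependent_bracketProd k hord n).comp f hf using 1
  funext b
  simp [f, bracketProd]

end LinearIndependence

/-! ### Independence of the presentation -/

section Independence

variable {F F' G : Type*} [Group F] [Group F'] [Group G]

theorem map_iterCommutator_le (f : F →* F') {R : Subgroup F} {R' : Subgroup F'}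
    (h : R ≤ R'.comap f) (n : ℕ) : iterCommutator R n ≤ (iterCommutator R' n).comap f := by
  induction n with
  | zero => exact h
  | succ n ih =>
    refine commutator_le.mpr fun a ha b _ => ?_
    rw [mem_comap, map_commutatorElement]
    exact commutator_mem_commutator (ih ha) (mem_top _)

/-- A homomorphism over `G` maps `R ∩ γ_{c+1}(F)` to the corresponding subgroup. -/
theorem ker_inf_le_comap {π : F →* G} {π' : F' →* G} {f : F →* F'} (hf : π'.comp f = π) (c : ℕ) :
    π.ker ⊓ (⊤ : Subgroup F).lowerCentralSeries c ≤
      (π'.ker ⊓ (⊤ : Subgroup F').lowerCentralSeries c).comap f := by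
  subst hf
  refine fun w hw => ⟨hw.1, ?_⟩
  have h := map_iterCommutator_le f (R := ⊤) (R' := ⊤) le_top c
  rw [iterCommutator_top, iterCommutator_top] at h
  exact h hw.2

/-- The homomorphism of Baer invariants induced by a homomorphism over `G`. -/
def multiplierMap {π : F →* G} {π' : F' →* G} (f : F →* F') (hf : π'.comp f = π) (c : ℕ) :
    NilpotentMultiplier π c →* NilpotentMultiplier π' c :=
  QuotientGroup.map _ _ ((f.comp (Subgroup.subtype _)).codRestrict _
    fun w => ker_inf_le_comap hf c w.2) <| by
      subst hf
      exact fun w hw => map_iterCommutator_le f (R' := π'.ker) (fun _ h => h) c hw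

/-- Two homomorphisms over `G` agree on `γ_{c+1}(F)` modulo `[R', F', …, F']`. -/
theorem map_div_map_mem {π' : F' →* G} {f g : F →* F'} (h : π'.comp f = π'.comp g) (c : ℕ) {w : F}
    (hw : w ∈ (⊤ : Subgroup F).lowerCentralSeries c) :
    f w * (g w)⁻¹ ∈ iterCommutator π'.ker c := by
  induction c generalizing w with
  | zero =>
    have := DFunLike.congr_fun h w
    simp only [MonoidHom.comp_apply] at this
    simp [iterCommutator, MonoidHom.mem_ker, this]
  | succ c ih =>
    let N := iterCommutator π'.ker (c + 1)
    -- The claim says that `f` and `g` become equal modulo `N`, a condition that is closed under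
    -- products, so it may be checked on commutators.
    have key : (⊤ : Subgroup F).lowerCentralSeries (c + 1) ≤
        ((QuotientGroup.mk' N).comp f).eqLocus ((QuotientGroup.mk' N).comp g) := by
      rw [Subgroup.lowerCentralSeries_succ, commutator_le]
      intro p hp q _
      let a := f p * (g p)⁻¹
      let b := f q * (g q)⁻¹
      have ha : a ∈ iterCommutator π'.ker c := ih hp
      have hb : b ∈ π'.ker := by
        have := DFunLike.congr_fun h q
        simp only [MonoidHom.comp_apply] at this
        simp [b, MonoidHom.mem_ker, this]
      have hfp : f p = a * g p := by simp [a]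
      have hfq : f q = b * g q := by simp [b]
      have hgp : g p ∈ (⊤ : Subgroup F').lowerCentralSeries c := by
        have h := map_iterCommutator_le g (R := ⊤) (R' := ⊤) le_top c
        rw [iterCommutator_top, iterCommutator_top] at h
        exact h hp
      -- Modulo `N`, the element `a` is central, and `b` commutes with `g p` and with `[g p, g q]`.
      have ha' : ∀ z : F', Commute (a : F' ⧸ N) (z : F' ⧸ N) := fun z =>
        commutatorElement_mem_iff_commute.mp (commutator_mem_commutator ha (mem_top z))
      have hb₁ : Commute (b : F' ⧸ N) (g p : F' ⧸ N) := by
        refine commutatorElement_mem_iff_commute.mp ?_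
        have := commutator_iterCommutator_lowerCentralSeries_le π'.ker 0 c
        rw [zero_add] at this
        exact this (commutator_mem_commutator hb hgp)
      have hb₂ : Commute (b : F' ⧸ N) (⁅g p, g q⁆ : F') := by
        refine commutatorElement_mem_iff_commute.mp ?_
        have := commutator_iterCommutator_lowerCentralSeries_le π'.ker 0 (c + 1)
        rw [zero_add] at this
        exact commutator_le_left N ⊤
          (this (commutator_mem_commutator hb (commutator_mem_commutator hgp (mem_top _))))
      change ((f ⁅p, q⁆ : F') : F' ⧸ N) = ((g ⁅p, q⁆ : F') : F' ⧸ N)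
      rw [map_commutatorElement, map_commutatorElement, hfp, hfq]
      have e : ⁅a * g p, b * g q⁆ = a * (g p * (b * g q) * (g p)⁻¹) * a⁻¹ * (b * g q)⁻¹ := by
        simp [commutatorElement_def, mul_assoc]
      rw [e]
      calc ((a * (g p * (b * g q) * (g p)⁻¹) * a⁻¹ * (b * g q)⁻¹ : F') : F' ⧸ N)
          = (a : F' ⧸ N) * ((g p * (b * g q) * (g p)⁻¹ : F') : F' ⧸ N) * (a : F' ⧸ N)⁻¹ *
            ((b * g q : F') : F' ⧸ N)⁻¹ := rfl
        _ = ((g p * (b * g q) * (g p)⁻¹ : F') : F' ⧸ N) * ((b * g q : F') : F' ⧸ N)⁻¹ := by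
          rw [(ha' _).eq, mul_inv_cancel_right]
        _ = ((g p : F' ⧸ N) * b) * (g q * (g p)⁻¹ * (g q)⁻¹) * (b : F' ⧸ N)⁻¹ := by
          simp only [QuotientGroup.mk_mul, QuotientGroup.mk_inv, mul_inv_rev, mul_assoc]
        _ = (b : F' ⧸ N) * ((⁅g p, g q⁆ : F') : F' ⧸ N) * (b : F' ⧸ N)⁻¹ := by
          rw [← hb₁.eq]
          simp only [commutatorElement_def, QuotientGroup.mk_mul, QuotientGroup.mk_inv, mul_assoc]
        _ = _ := by rw [hb₂.eq, mul_inv_cancel_right]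
    have := key hw
    change ((f w : F') : F' ⧸ N) = ((g w : F') : F' ⧸ N) at this
    rw [← div_eq_mul_inv]
    exact QuotientGroup.eq_iff_div_mem.mp this

theorem multiplierMap_comp_eq_id {π : F →* G} {π' : F' →* G} (f : F →* F') (hf : π'.comp f = π)
    (g : F' →* F) (hg : π.comp g = π') (c : ℕ) :
    (multiplierMap g hg c).comp (multiplierMap f hf c) = MonoidHom.id _ := by
  refine QuotientGroup.monoidHom_ext _ (MonoidHom.ext fun w => ?_)
  refine QuotientGroup.eq_iff_div_mem.mpr ?_
  have h : π.comp (g.comp f) = π.comp (MonoidHom.id F) := by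
    rw [← MonoidHom.comp_assoc, hg, hf]
    rfl
  have := map_div_map_mem h c w.2.2
  rw [← div_eq_mul_inv] at this
  exact this

/-- The Baer invariant does not depend on the free presentation. -/
theorem nonempty_mulEquiv_nilpotentMultiplier [IsFreeGroup F] [IsFreeGroup F'] {π : F →* G}
    {π' : F' →* G} (h : Function.Surjective π) (h' : Function.Surjective π') (c : ℕ) :
    Nonempty (NilpotentMultiplier π c ≃* NilpotentMultiplier π' c) := by
  let f : F →* F' := IsFreeGroup.lift fun a => Function.surjInv h' (π (IsFreeGroup.of a))
  let g : F' →* F := IsFreeGroup.lift fun a => Function.surjInv h (π' (IsFreeGroup.of a))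
  have hf : π'.comp f = π := IsFreeGroup.ext_hom fun a => by
    simp [f, Function.surjInv_eq]
  have hg : π.comp g = π' := IsFreeGroup.ext_hom fun a => by
    simp [g, Function.surjInv_eq]
  exact ⟨MonoidHom.toMulEquiv (multiplierMap f hf c) (multiplierMap g hg c)
    (multiplierMap_comp_eq_id f hf g hg c) (multiplierMap_comp_eq_id g hg f hf c)⟩

end Independence

/-! ### Bases of groups of finite exponent -/

/-- A module over `ZMod d` is free on a finite family that generates it as a group and that some
homomorphism maps to a linearly independent family. -/
theorem nonempty_addEquiv_of_linearIndependent {N M ι : Type*} [AddCommGroup N] [AddCommGroup M]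
    {d : ℕ} [Module (ZMod d) N] [Module (ZMod d) M] [Finite ι] (φ : N →+ M) (v : ι → N)
    (hv : AddSubgroup.closure (Set.range v) = ⊤)
    (hli : LinearIndependent (ZMod d) fun i => φ (v i)) :
    Nonempty (N ≃+ (Fin (Nat.card ι) → ZMod d)) := by
  have hv' : LinearIndependent (ZMod d) v := .of_comp (φ.toZModLinearMap d) hli
  have hspan : ⊤ ≤ Submodule.span (ZMod d) (Set.range v) := fun a _ =>
    (AddSubgroup.closure_le (Submodule.span (ZMod d) (Set.range v)).toAddSubgroup).mpr
      Submodule.subset_span (hv ▸ AddSubgroup.mem_top a)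
  exact ⟨((Module.Basis.mk hv' hspan).reindex (Finite.equivFin ι)).equivFun.toAddEquiv⟩

/-- The same for an abelian group of exponent dividing `d`, written multiplicatively. -/
theorem nonempty_mulEquiv_of_linearIndependent {Q M ι : Type*} [Group Q] [AddCommGroup M] {d : ℕ}
    [Module (ZMod d) M] [Finite ι] (hcomm : ∀ a b : Q, a * b = b * a) (hexp : ∀ a : Q, a ^ d = 1)
    (φ : Q →* Multiplicative M) (q : ι → Q) (hq : closure (Set.range q) = ⊤)
    (hli : LinearIndependent (ZMod d) fun i => (φ (q i)).toAdd) :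
    Nonempty (Q ≃* Multiplicative (Fin (Nat.card ι) → ZMod d)) := by
  let _ : CommGroup Q := { ‹Group Q› with mul_comm := hcomm }
  let _ : Module (ZMod d) (Additive Q) := AddCommGroup.zmodModule fun a => hexp a.toMul
  have hmem : ∀ x ∈ closure (Set.range q),
      Additive.ofMul x ∈ AddSubgroup.closure (Set.range fun i => Additive.ofMul (q i)) :=
    fun x hx => by
      induction hx using closure_induction with
      | mem x hx =>
        obtain ⟨i, rfl⟩ := hx
        exact AddSubgroup.subset_closure ⟨i, rfl⟩
      | one => exact zero_mem _
      | mul x y _ _ hx hy => exact add_mem hx hy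
      | inv x _ hx => exact neg_mem hx
  have hv : AddSubgroup.closure (Set.range fun i => Additive.ofMul (q i)) = ⊤ :=
    eq_top_iff.mpr fun a _ => hmem a.toMul (hq ▸ mem_top _)
  obtain ⟨f⟩ := nonempty_addEquiv_of_linearIndependent (MonoidHom.toAdditiveLeft φ) _ hv hli
  exact ⟨AddEquiv.toMultiplicativeRight f⟩

/-! ### The product of two cyclic groups -/

section CyclicProduct

variable {r s : ℕ}

/-- The normal subgroup of relators of the presentation `⟨x, y ∣ x ^ r, y ^ s, γ₂⟩`. -/
abbrev relators (r s : ℕ) : Subgroup (FreeGroup (Fin 2)) :=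
  normalClosure (cyclicProductRels r s 1)

theorem of_zero_pow_mem_relators : FreeGroup.of 0 ^ r ∈ relators r s :=
  subset_normalClosure (Or.inl (Or.inl rfl))

theorem of_one_pow_mem_relators : FreeGroup.of 1 ^ s ∈ relators r s :=
  subset_normalClosure (Or.inl (Or.inr rfl))

theorem lowerCentralSeries_one_le_relators :
    (⊤ : Subgroup (FreeGroup (Fin 2))).lowerCentralSeries 1 ≤ relators r s :=
  fun _ h => subset_normalClosure (Or.inr h)

theorem pow_gcd_mem {F : Type*} [Group F] {N : Subgroup F} [N.Normal] {z : F} (hr : z ^ r ∈ N)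
    (hs : z ^ s ∈ N) : z ^ r.gcd s ∈ N := by
  rw [← QuotientGroup.eq_one_iff, QuotientGroup.mk_pow, ← orderOf_dvd_iff_pow_eq_one] at *
  exact Nat.dvd_gcd hr hs

/-- The group `γ_{c+1} / [R, F, …, F]` has exponent dividing `gcd r s`. In weight `2` it is
generated by `[x, y]`, whose powers are `[x ^ r, y]` and, up to inversion, `[y ^ s, x]`; bracketing
with further elements preserves the property. -/
theorem pow_gcd_mem_iterCommutator [LinearOrder (FreeMagma (Fin 2))]
    (hord : ∀ a b : FreeMagma (Fin 2), a.length < b.length → a < b) {c : ℕ} (hc : 1 ≤ c)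
    {w : FreeGroup (Fin 2)} (hw : w ∈ (⊤ : Subgroup (FreeGroup (Fin 2))).lowerCentralSeries c) :
    w ^ r.gcd s ∈ iterCommutator (relators r s) c := by
  have hle := lowerCentralSeries_le_iterCommutator
    (lowerCentralSeries_one_le_relators (r := r) (s := s))
  induction c, hc using Nat.le_induction generalizing w with
  | base =>
    have hbr : ∀ (i j : Fin 2) (m : ℕ), FreeGroup.of i ^ m ∈ relators r s →
        ⁅FreeGroup.of i, FreeGroup.of j⁆ ^ m ∈ iterCommutator (relators r s) 1 := fun i j m hm =>
      commutatorElement_pow_mem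
        (hle 1 (commutator_mem_weightSeries (i := 1) (j := 2) (mem_top _)
          (commutator_mem_commutator (mem_top _) (mem_top _)) le_rfl))
        (commutator_mem_commutator hm (mem_top _))
    have h₀₁ : ⁅FreeGroup.of (0 : Fin 2), FreeGroup.of 1⁆ ^ r.gcd s ∈
        iterCommutator (relators r s) 1 := by
      refine pow_gcd_mem (hbr 0 1 r of_zero_pow_mem_relators) ?_
      rw [← inv_mem_iff, ← inv_pow, commutatorElement_inv]
      exact hbr 1 0 s of_one_pow_mem_relators
    have hspan := weightSeries_le_basicSubgroup_self FreeGroup.of hord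
      (FreeGroup.closure_range_of (Fin 2)) one_le_two hw
    refine pow_mem_of_mem_closure (H := weightSeries _ 2) ?_ ?_ ?_ hspan
    · rw [commutator_weightSeries_top one_le_two]
      exact hle 1
    · exact fun t ht => basicSubgroup_le FreeGroup.of 2 (subset_closure ht)
    · rintro _ (⟨b, ⟨hb, hlen⟩, rfl⟩ | ht)
      · cases hb with
        | of a => cases hlen
        | mul u v hu hv hvu h =>
          rw [length_mul] at hlen
          have hupos := u.length_pos
          have hvpos := v.length_pos
          cases u with
          | mul u₁ u₂ =>
            have h₁ := u₁.length_pos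
            have h₂ := u₂.length_pos
            change u₁.length + u₂.length + v.length = 2 at hlen
            omega
          | of i =>
            cases v with
            | mul v₁ v₂ =>
              have h₁ := v₁.length_pos
              have h₂ := v₂.length_pos
              change _ + (v₁.length + v₂.length) = 2 at hlen
              omega
            | of j =>
              change ⁅FreeGroup.of i, FreeGroup.of j⁆ ^ r.gcd s ∈ _
              fin_cases i <;> fin_cases j
              · exact absurd hvu (lt_irrefl _)
              · exact h₀₁
              · rw [← inv_mem_iff, ← inv_pow, commutatorElement_inv]
                exact h₀₁
              · exact absurd hvu (lt_irrefl _)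
      · exact pow_mem (hle 1 ht) _
  | succ c hc ih =>
    refine pow_mem_of_mem_closure
      (H := (⊤ : Subgroup (FreeGroup (Fin 2))).lowerCentralSeries (c + 1)) (hle (c + 1))
      subset_closure ?_ hw
    rintro _ ⟨p, hp, q, _, rfl⟩
    refine commutatorElement_pow_mem (hle (c + 1) ?_)
      (commutator_mem_commutator (ih hp) (mem_top q))
    rw [commutatorElement_mem_comm]
    exact commutator_mem_commutator (commutator_mem_commutator hp (mem_top q)) (mem_top p)

/-- Over `ZMod (gcd r s)` the linear term of the Magnus image of each relator vanishes. -/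
theorem relators_le_comap_magnus :
    relators r s ≤ (congruenceSubgroup (FreeAlgebra (ZMod (r.gcd s)) (Fin 2)) 2).comap
      (magnus (FreeAlgebra.ι _)) := by
  have hpow : ∀ (i : Fin 2) (m : ℕ), r.gcd s ∣ m →
      magnus (FreeAlgebra.ι (ZMod (r.gcd s))) (FreeGroup.of i ^ m) ∈
        congruenceSubgroup (FreeAlgebra (ZMod (r.gcd s)) (Fin 2)) 2 := fun i m hm => by
    rw [map_pow]
    refine mem_succ_of_coeff_eq_zero le_rfl (pow_mem (magnus_mem _ _) m) ?_
    rw [coeff_pow_of_mem le_rfl (magnus_mem _ _),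
      ← map_natCast (algebraMap (ZMod (r.gcd s)) (FreeAlgebra (ZMod (r.gcd s)) (Fin 2))),
      (ZMod.natCast_eq_zero_iff m _).mpr hm, map_zero, zero_mul]
  refine normalClosure_le_normal ?_
  rintro w ((rfl | rfl) | hw)
  · exact hpow 0 r (Nat.gcd_dvd_left r s)
  · exact hpow 1 s (Nat.gcd_dvd_right r s)
  · exact weightSeries_le_comap_magnus _ one_le_two hw

/-- The Baer invariant, computed from the presentation on two generators: the classes of the basic
commutators of weight `c + 1` are a basis over `ZMod (gcd r s)`. They generate, and the leading
coefficient of the Magnus image maps them to linearly independent elements. -/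
theorem nonempty_nilpotentMultiplier_mulEquiv [LinearOrder (FreeMagma (Fin 2))]
    (hord : ∀ a b : FreeMagma (Fin 2), a.length < b.length → a < b) {c : ℕ} (hc : 1 ≤ c)
    {G : Type*} [Group G] {π : FreeGroup (Fin 2) →* G} (hπ : π.ker = relators r s) :
    Nonempty (NilpotentMultiplier π c ≃*
      Multiplicative (Fin (numBasicCommutators (Fin 2) (c + 1)) → ZMod (r.gcd s))) := by
  have hn : 1 ≤ c + 1 := Nat.le_add_left 1 c
  let H := π.ker ⊓ (⊤ : Subgroup (FreeGroup (Fin 2))).lowerCentralSeries c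
  have hH : H = weightSeries (FreeGroup (Fin 2)) (c + 1) := inf_eq_right.mpr
    ((Subgroup.lowerCentralSeries_antitone _ hc).trans (hπ ▸ lowerCentralSeries_one_le_relators))
  have hle : weightSeries (FreeGroup (Fin 2)) (c + 2) ≤ iterCommutator π.ker c :=
    lowerCentralSeries_le_iterCommutator (hπ ▸ lowerCentralSeries_one_le_relators) c
  let e : Fin 2 → FreeAlgebra (ZMod (r.gcd s)) (Fin 2) := FreeAlgebra.ι _
  let ψ : H →* Multiplicative (FreeAlgebra (ZMod (r.gcd s)) (Fin 2)) :=
    (leadingCoeffHom (A := FreeAlgebra (ZMod (r.gcd s)) (Fin 2)) hn).comp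
      (((magnus e).comp H.subtype).codRestrict _ fun w =>
        weightSeries_le_comap_magnus e hn (hH ▸ w.2))
  have hψ : (iterCommutator π.ker c).subgroupOf H ≤ ψ.ker := fun w hw => by
    have h := magnus_mem_of_mem_iterCommutator e (hπ.trans_le relators_le_comap_magnus) c hw
    rw [add_comm] at h
    exact congrArg Multiplicative.ofAdd
      (coeff_eq_zero_of_mem_succ (A := FreeAlgebra (ZMod (r.gcd s)) (Fin 2)) hn h)
  let q : basicCommutators (Fin 2) (c + 1) → NilpotentMultiplier π c := fun b =>
    QuotientGroup.mk ⟨groupBracket FreeGroup.of b.1, by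
      change _ ∈ H
      have h := groupBracket_mem FreeGroup.of b.1
      rwa [b.2.2, ← hH] at h⟩
  have : Finite {b : FreeMagma (Fin 2) // IsBasicCommutator b ∧ b.length = c + 1} :=
    finite_basicCommutators (c + 1)
  refine nonempty_mulEquiv_of_linearIndependent ?_ ?_ (QuotientGroup.lift _ ψ hψ) q ?_ ?_
  · rintro ⟨a⟩ ⟨b⟩
    refine commutatorElement_eq_one_iff_mul_comm.mp ?_
    refine (QuotientGroup.eq_one_iff (⁅a, b⁆ : H)).mpr ?_
    exact hle (commutator_mem_commutator a.2.2 (mem_top _))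
  · rintro ⟨a⟩
    refine (QuotientGroup.eq_one_iff (a ^ r.gcd s)).mpr ?_
    have := pow_gcd_mem_iterCommutator (r := r) (s := s) hord hc a.2.2
    rw [← hπ] at this
    exact this
  · have key : H ≤ ((closure (Set.range q)).comap (QuotientGroup.mk' _)).map H.subtype := by
      refine (hH.trans_le (weightSeries_le_basicSubgroup_self FreeGroup.of hord
        (FreeGroup.closure_range_of (Fin 2)) hn)).trans ((closure_le _).mpr ?_)
      rintro _ (⟨b, hb, rfl⟩ | ht)
      · exact ⟨_, subset_closure ⟨⟨b, hb⟩, rfl⟩, rfl⟩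
      · have htH := hH ▸ weightSeries_antitone (Nat.le_succ _) ht
        refine ⟨⟨_, htH⟩, ?_, rfl⟩
        have h1 : (QuotientGroup.mk ⟨_, htH⟩ : NilpotentMultiplier π c) = 1 :=
          (QuotientGroup.eq_one_iff _).mpr (hle ht)
        refine mem_comap.mpr ?_
        rw [QuotientGroup.mk'_apply, h1]
        exact one_mem _
    refine eq_top_iff.mpr ?_
    rintro ⟨a⟩ _
    obtain ⟨a', ha', h⟩ := key a.2
    rw [Subtype.ext h] at ha'
    exact ha'
  · have hli := linearIndependent_ringBracket (ZMod (r.gcd s)) hord (c + 1)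
    have heq : (fun b : basicCommutators (Fin 2) (c + 1) => ringBracket e b.1) =
        fun b => (QuotientGroup.lift _ ψ hψ (q b)).toAdd := funext fun b => by
      have h := coeff_magnus_groupBracket e b.1
      rw [b.2.2] at h
      exact h.symm
    rw [heq] at hli
    exact hli

/-- The presentation of `ℤ_r × ℤ_s` by the two standard generators. -/
def cyclicProductHom (r s : ℕ) :
    FreeGroup (Fin 2) →* Multiplicative (ZMod r) × Multiplicative (ZMod s) :=
  FreeGroup.lift ![(.ofAdd 1, 1), (1, .ofAdd 1)]

theorem cyclicProductHom_apply (m n : ℤ) :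
    cyclicProductHom r s (FreeGroup.of 0 ^ m * FreeGroup.of 1 ^ n) =
      (.ofAdd (m : ZMod r), .ofAdd (n : ZMod s)) := by
  simp [cyclicProductHom, ← ofAdd_zsmul]

theorem cyclicProductHom_surjective : Function.Surjective (cyclicProductHom r s) := by
  rintro ⟨a, b⟩
  obtain ⟨m, hm⟩ := ZMod.intCast_surjective a.toAdd
  obtain ⟨n, hn⟩ := ZMod.intCast_surjective b.toAdd
  exact ⟨_, (cyclicProductHom_apply m n).trans (by rw [hm, hn]; rfl)⟩

theorem ker_cyclicProductHom : (cyclicProductHom r s).ker = relators r s := by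
  have hcomm : (⊤ : Subgroup (FreeGroup (Fin 2))).lowerCentralSeries 1 ≤
      (cyclicProductHom r s).ker := by
    rw [top_lowerCentralSeries_one]
    exact Abelianization.commutator_subset_ker _
  refine le_antisymm (fun w hw => ?_) (normalClosure_le_normal ?_)
  · have hgen : ∀ v : FreeGroup (Fin 2), Abelianization.of v ∈
        closure {Abelianization.of (FreeGroup.of (0 : Fin 2)),
          Abelianization.of (FreeGroup.of (1 : Fin 2))} := fun v => by
      induction v using FreeGroup.induction_on with
      | C1 => simp
      | of i => fin_cases i <;> exact subset_closure (by simp)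
      | inv_of i h => rw [map_inv]; exact inv_mem h
      | mul v w hv hw => rw [map_mul]; exact mul_mem hv hw
    obtain ⟨m, n, hmn⟩ := mem_closure_pair.mp (hgen w)
    rw [← map_zpow, ← map_zpow, ← map_mul] at hmn
    have hdiv : w / (FreeGroup.of 0 ^ m * FreeGroup.of 1 ^ n) ∈
        (⊤ : Subgroup (FreeGroup (Fin 2))).lowerCentralSeries 1 :=
      QuotientGroup.eq_iff_div_mem.mp hmn.symm
    have h := hcomm hdiv
    rw [MonoidHom.mem_ker, map_div, MonoidHom.mem_ker.mp hw, one_div, inv_eq_one,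
      cyclicProductHom_apply, Prod.mk_eq_one, ofAdd_eq_one, ofAdd_eq_one,
      ZMod.intCast_zmod_eq_zero_iff_dvd, ZMod.intCast_zmod_eq_zero_iff_dvd] at h
    obtain ⟨⟨m, rfl⟩, ⟨n, rfl⟩⟩ := h
    have := mul_mem (lowerCentralSeries_one_le_relators (r := r) (s := s) hdiv)
      (mul_mem (zpow_mem (of_zero_pow_mem_relators (r := r) (s := s)) m)
        (zpow_mem (of_one_pow_mem_relators (r := r) (s := s)) n))
    simpa [zpow_mul] using this
  · rintro w ((rfl | rfl) | hw)
    · simp [MonoidHom.mem_ker, cyclicProductHom, ← ofAdd_nsmul]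
    · simp [MonoidHom.mem_ker, cyclicProductHom, ← ofAdd_nsmul]
    · exact hcomm hw

end CyclicProduct

end Baer

theorem theorem3p1
    [LinearOrder (FreeMagma (Fin 2))]
    (hord : ∀ a b : FreeMagma (Fin 2), a.length < b.length → a < b)
    (r s c : ℕ) (hr : 0 < r) (hs : 0 < s) (hc : 1 ≤ c)
    {F : Type*} [Group F] [IsFreeGroup F] :
    (∀ π : F →* Baer.CyclicNilpotentProduct r s 1, Function.Surjective π →
      Nonempty (Baer.NilpotentMultiplier π c ≃*
        Multiplicative (Fin (Baer.numBasicCommutators (Fin 2) (c + 1)) → ZMod (Nat.gcd r s)))) ∧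
    (∀ π : F →* Multiplicative (ZMod r) × Multiplicative (ZMod s), Function.Surjective π →
      Nonempty (Baer.NilpotentMultiplier π c ≃*
        Multiplicative (Fin (Baer.numBasicCommutators (Fin 2) (c + 1)) → ZMod (Nat.gcd r s)))) := by
  refine ⟨fun π hπ => ?_, fun π hπ => ?_⟩
  · obtain ⟨f⟩ := Baer.nonempty_mulEquiv_nilpotentMultiplier hπ
      (PresentedGroup.mk_surjective (Baer.cyclicProductRels r s 1)) c
    obtain ⟨g⟩ := Baer.nonempty_nilpotentMultiplier_mulEquiv hord hc
      (π := PresentedGroup.mk (Baer.cyclicProductRels r s 1)) (QuotientGroup.ker_mk' _)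
    exact ⟨f.trans g⟩
  · obtain ⟨f⟩ := Baer.nonempty_mulEquiv_nilpotentMultiplier hπ
      Baer.cyclicProductHom_surjective c
    obtain ⟨g⟩ := Baer.nonempty_nilpotentMultiplier_mulEquiv hord hc
      (Baer.ker_cyclicProductHom (r := r) (s := s))
    exact ⟨f.trans g⟩
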